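/- Let $K$ be an algebraically closed field of characteristic $0$, let $C\subseteq K$ be an algebraically closed subfield, and let $\mathcal K_C=(K;+,\cdot,C)$ be the field $K$ with a unary predicate for $C$. Assume that $\mathcal K_C$ is $\aleph_0$-saturated. Then every strongly minimal set definable (with parameters) in $\mathcal K_C$ is non-orthogonal to $C$. Here a definable set $S\subseteq K^n$ is *strongly minimal* if it is infinite and, in every elementary extension of $\mathcal K_C$, every definable (with parameters) subset of the set defined by the formula defining $S$ is finite or cofinite in it. And $S$ is *non-orthogonal* to $C$ if there is an infinite relation $R\subseteq S\times C$, definable in $\mathcal K_C$ with parameters, such that both projections $R\to S$ and $R\to C$ are finite-to-one. -/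

import Mathlib

universe u v w

/-- The symbols of the language with a single symbol, a unary predicate. -/
inductive PredRel : ℕ → Type
  | mem : PredRel 1

/-- The language with a single symbol: a unary predicate. -/
def predLanguage : FirstOrder.Language.{0, 0} where
  Functions := fun _ => Empty
  Relations := PredRel

/-- The language of pairs of fields: the language of rings together with a unary predicate. -/
abbrev pairLanguage : FirstOrder.Language.{0, 0} :=
  FirstOrder.Language.ring.sum predLanguage

/-- The interpretation of the unary predicate as a given subset. -/
@[reducible]
def predStructure {K : Type u} (C : Set K) : predLanguage.Structure K where
  funMap := fun e => Empty.elim e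
  RelMap := fun r => match r with
    | PredRel.mem => fun x => x 0 ∈ C

/-- The structure `(K; +, ·, C)` of a field `K` with a distinguished subfield `C`. -/
@[reducible]
def pairStructure {K : Type u} [Field K] (C : Subfield K) : pairLanguage.Structure K :=
  letI : FirstOrder.Language.ring.Structure K := (FirstOrder.Ring.compatibleRingOfRing K).toStructure
  letI : predLanguage.Structure K := predStructure (C : Set K)
  FirstOrder.Language.sumStructure FirstOrder.Language.ring predLanguage K

section ModelTheory

variable (L : FirstOrder.Language.{v, w}) {M : Type u} [L.Structure M]

variable (M) in
/-- `ℵ₀`-saturation: every set of formulas in finitely many variables, with parameters from a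
finite set `A`, that is finitely satisfiable in `M` is realized in `M`. -/
def IsOmegaSaturated : Prop :=
  ∀ (A : Set M), A.Finite → ∀ (n : ℕ) (p : Set (L.Formula (A ⊕ Fin n))),
    (∀ F : Finset (L.Formula (A ⊕ Fin n)), (F : Set (L.Formula (A ⊕ Fin n))) ⊆ p →
      ∃ x : Fin n → M, ∀ φ ∈ F, φ.Realize (Sum.elim (fun a : A => (a : M)) x)) →
    ∃ x : Fin n → M, ∀ φ ∈ p, φ.Realize (Sum.elim (fun a : A => (a : M)) x)

/-- The set of solutions in `N` of a formula `φ` whose parameters, taken in `M`, are interpreted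
in `N` through a map `f : M → N`. -/
def solutionSet {N : Type u} [L.Structure N] (f : M → N) {n : ℕ}
    (φ : L.Formula (M ⊕ Fin n)) : Set (Fin n → N) :=
  {x | φ.Realize (Sum.elim f x)}

/-- `S ⊆ Mⁿ` is strongly minimal: it is infinite, it is defined by a formula with parameters
in `M`, and in every elementary extension `N` of `M` every subset of the solution set of that
formula which is definable with parameters in `N` is finite or cofinite in it.
(The choice of the formula is immaterial, by elementarity; extensions in the universe of `M`
suffice, since a failure in any elementary extension yields one in an ultrapower of `M`.) -/
def IsStronglyMinimal {n : ℕ} (S : Set (Fin n → M)) : Prop :=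
  S.Infinite ∧ ∃ φ : L.Formula (M ⊕ Fin n), S = solutionSet L (id : M → M) φ ∧
    ∀ (N : Type u) [L.Structure N] (f : L.ElementaryEmbedding M N) (T : Set (Fin n → N)),
      (Set.univ : Set N).Definable L T → T ⊆ solutionSet L (f : M → N) φ →
        T.Finite ∨ (solutionSet L (f : M → N) φ \ T).Finite

/-- Non-orthogonality of strongly minimal sets `S ⊆ Mᵐ` and `T ⊆ Mⁿ`: there is an infinite
relation `R ⊆ S × T`, definable with parameters, both of whose projections, to `S` and to `T`,
are finite-to-one. -/
def IsNonorthogonal {m n : ℕ} (S : Set (Fin m → M)) (T : Set (Fin n → M)) : Prop :=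
  ∃ R : Set (Fin m ⊕ Fin n → M), (Set.univ : Set M).Definable L R ∧ R.Infinite ∧
    (∀ s t, Sum.elim s t ∈ R → s ∈ S ∧ t ∈ T) ∧
    (∀ s ∈ S, {t | Sum.elim s t ∈ R}.Finite) ∧
    (∀ t ∈ T, {s | Sum.elim s t ∈ R}.Finite)

end ModelTheory

/-! Write acl for field-theoretic algebraic closure in `K`. Extend a transcendence basis `B₀` of `C`
to one `B` of `K`. The set `S` is definable over a finite set `A ⊆ acl(B₁)` with `B₁ ⊆ B` finite,
and saturation gives `x ∈ S` with a coordinate `x i ∉ acl(B₁)`. Some `c ∈ B \ B₁` then satisfies `x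
i ∉ R := acl(B \ {c})`. As `K` has transcendence degree one over `R`, automorphisms over `R` move
any element outside `R` to any other. Those preserving `C` also preserve `S`, because `A ⊆ R`.

If `c ∈ B₀`, the automorphisms `c ↦ c + k` preserve `C`. They carry an algebraic relation over `R`
between `c` and `x i` to infinitely many points, and this curve witnesses non-orthogonality
(`isNonorthogonal_of_curve`). If `c ∉ B₀`, then `C ⊆ R` is fixed pointwise and `x i` moves freely;
the coset `x i + C` then splits `S` into two infinite pieces, against minimality
(`false_of_free_coordinate`). -/

/-- Two families indexed by the same type that are transcendence bases of algebraically closed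
fields are matched by an isomorphism. -/
theorem exists_algEquiv_of_isTranscendenceBasis {R K ι : Type*} [CommRing R] [Field K]
    [Algebra R K] [IsAlgClosed K] {v w : ι → K}
    (hv : IsTranscendenceBasis R v) (hw : IsTranscendenceBasis R w) :
    ∃ σ : K ≃ₐ[R] K, ∀ i, σ (v i) = w i := by
  let := IsAlgClosed.isAlgClosure_of_transcendence_basis v hv
  let := IsAlgClosed.isAlgClosure_of_transcendence_basis w hw
  let e : Algebra.adjoin R (Set.range v) ≃ₐ[R] Algebra.adjoin R (Set.range w) :=
    hv.1.aevalEquiv.symm.trans hw.1.aevalEquiv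
  have he : ∀ s : Algebra.adjoin R (Set.range v), IsAlgClosure.equivOfEquiv K K e.toRingEquiv (s : K) = (e s : K) := fun s =>
    IsAlgClosure.equivOfEquiv_algebraMap K K e.toRingEquiv s
  refine ⟨AlgEquiv.ofRingEquiv (f := IsAlgClosure.equivOfEquiv K K e.toRingEquiv)
    fun r => ?_, fun i => ?_⟩
  · simpa using he (algebraMap R _ r)
  · have h := he (hv.1.aevalEquiv (MvPolynomial.X i))
    simpa [e] using h

theorem exists_algEquiv_apply_eq {R K : Type*} [CommRing R] [Field K] [Algebra R K] [IsAlgClosed K]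
    {y z : K} (hy : IsTranscendenceBasis R fun _ : Unit => y)
    (hz : IsTranscendenceBasis R fun _ : Unit => z) : ∃ σ : K ≃ₐ[R] K, σ y = z := by
  obtain ⟨σ, hσ⟩ := exists_algEquiv_of_isTranscendenceBasis hy hz
  exact ⟨σ, hσ ()⟩

theorem Subfield.mem_of_isAlgebraic {K : Type*} [Field K] (C : Subfield K) [IsAlgClosed C] {x : K}
    (hx : IsAlgebraic C x) : x ∈ C := by
  have h := minpoly.mem_range_of_degree_eq_one C x
    (IsAlgClosed.degree_eq_one_of_irreducible C (minpoly.irreducible hx.isIntegral))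
  obtain ⟨c, rfl⟩ := h
  exact c.2

/-! ### Algebraic closure as a matroid closure -/

namespace AlgebraicIndependent

variable {K : Type*} [Field K] [CharZero K]

local notation "𝕄" => AlgebraicIndependent.matroid ℤ K

theorem mem_matroid_closure_iff {s : Set K} {x : K} :
    x ∈ (𝕄).closure s ↔ IsAlgebraic (Algebra.adjoin ℤ s) x := by
  rw [matroid_closure_eq, SetLike.mem_coe, Subalgebra.mem_algebraicClosure]

theorem exists_subalgebra_eq_matroid_closure (s : Set K) :
    ∃ R : Subalgebra ℤ K, (R : Set K) = (𝕄).closure s ∧ ∀ a : K, IsAlgebraic R a → a ∈ R := by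
  obtain ⟨R, hR, h⟩ := matroid_isFlat_iff.1 ((𝕄).isFlat_closure s)
  refine ⟨R, hR, fun a ha => ?_⟩
  rw [← SetLike.mem_coe, hR]
  exact h a ha

/-- A set containing a basis of an algebraically closed subfield `C` inside `C` pins down `C`
under automorphisms. -/
theorem map_mem_of_subset_closure {C : Subfield K} [IsAlgClosed C] {B₀ : Set K}
    (hC : (C : Set K) ⊆ (𝕄).closure B₀) (σ : K ≃+* K) (hσ : ∀ b ∈ B₀, σ b ∈ C) {z : K}
    (hz : z ∈ C) : σ z ∈ C := by
  -- Transporting an equation for `z` over `ℤ[B₀]` by `σ` gives one for `σ z` with coefficients in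
  -- `C`.
  refine C.mem_of_isAlgebraic ?_
  have h := mem_matroid_closure_iff.1 (hC hz)
  have hA : ∀ a ∈ Algebra.adjoin ℤ B₀, σ a ∈ C := by
    intro a ha
    induction ha using Algebra.adjoin_induction with
    | mem x hx => exact hσ x hx
    | algebraMap r => simp
    | add x y _ _ hx hy => rw [map_add]; exact add_mem hx hy
    | mul x y _ _ hx hy => rw [map_mul]; exact mul_mem hx hy
  let f : Algebra.adjoin ℤ B₀ →+* C :=
    (σ.toRingHom.comp (Algebra.adjoin ℤ B₀).val.toRingHom).codRestrict C fun a => hA a a.2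
  refine h.ringHom_of_comp_eq f σ.toRingHom ?_ ?_
  · intro a b hab
    have : σ (a : K) = σ (b : K) := congrArg (fun c : C => (c : K)) hab
    exact Subtype.ext (σ.injective this)
  · ext a
    rfl

theorem exists_base_of_subfield (C : Subfield K) : ∃ B₀ B : Set K,
    B₀ ⊆ C ∧ (C : Set K) ⊆ (𝕄).closure B₀ ∧ B₀ ⊆ B ∧ (𝕄).IsBase B := by
  obtain ⟨B₀, h₀⟩ := (𝕄).exists_isBasis (C : Set K)
  obtain ⟨B, hB, hBB⟩ := h₀.indep.exists_isBase_superset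
  exact ⟨B₀, B, h₀.subset, h₀.subset_closure, hBB, hB⟩

theorem exists_finite_subset_closure {B A : Set K} (hA : A.Finite)
    (hAB : A ⊆ (𝕄).closure B) : ∃ B₁ ⊆ B, B₁.Finite ∧ A ⊆ (𝕄).closure B₁ := by
  induction A, hA using Set.Finite.induction_on with
  | empty => exact ⟨∅, by simp, by simp, by simp⟩
  | @insert a s _ _ ih =>
    obtain ⟨B₁, h1, h2, h3⟩ := ih ((Set.subset_insert a s).trans hAB)
    obtain ⟨I, hI, hIf, -, ha⟩ := Matroid.exists_mem_finite_closure_of_mem_closure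
      (hAB (Set.mem_insert a s))
    refine ⟨B₁ ∪ I, Set.union_subset h1 hI, h2.union hIf, Set.insert_subset ?_ ?_⟩
    · exact (𝕄).closure_subset_closure Set.subset_union_right ha
    · exact h3.trans ((𝕄).closure_subset_closure Set.subset_union_left)

/-- For subsets of an independent set, closure commutes with intersection, and the sets `B \ {c}`
with `c ∈ B \ B₁` intersect in `B₁`. -/
theorem exists_notMem_closure_diff_singleton {B B₁ : Set K} (hB : (𝕄).IsBase B) (h₁ : B₁ ⊆ B)
    {y : K} (hy : y ∉ (𝕄).closure B₁) : ∃ c ∈ B \ B₁, y ∉ (𝕄).closure (B \ {c}) := by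
  by_contra! h
  have hne : (B \ B₁).Nonempty := by
    rw [Set.nonempty_iff_ne_empty]
    intro h0
    have : B₁ = B := h₁.antisymm (Set.sdiff_eq_empty.1 h0)
    rw [this, hB.closure_eq] at hy
    exact hy (Set.mem_univ y)
  have := hne.coe_sort
  have key := hB.indep.closure_iInter_eq_biInter_closure_of_forall_subset
    (Js := fun c : ↥(B \ B₁) => B \ {(c : K)}) fun c => Set.sdiff_subset
  have : (⋂ c : ↥(B \ B₁), B \ {(c : K)}) ⊆ B₁ := by
    intro z hz
    rw [Set.mem_iInter] at hz
    by_contra hz1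
    obtain ⟨⟨c, hc⟩⟩ := this
    exact (hz ⟨z, (hz ⟨c, hc⟩).1, hz1⟩).2 rfl
  apply hy
  apply (𝕄).closure_subset_closure this
  rw [key, Set.mem_iInter]
  exact fun c => h c c.2

/-- By exchange, `y` can replace `c` in the basis `B`. -/
theorem isTranscendenceBasis_of_notMem_closure {B : Set K} (hB : (𝕄).IsBase B) {c : K}
    (hc : c ∈ B) {R : Subalgebra ℤ K} (hR : (R : Set K) = (𝕄).closure (B \ {c}))
    (hflat : ∀ a : K, IsAlgebraic R a → a ∈ R) {y : K} (hy : y ∉ R) :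
    IsTranscendenceBasis R fun _ : Unit => y := by
  have hy' : y ∉ (𝕄).closure (B \ {c}) := by rwa [← hR]
  have hindep : AlgebraicIndependent R fun _ : Unit => y :=
    (algebraicIndependent_unique_type_iff).2 fun h => hy (hflat y h)
  rw [hindep.isTranscendenceBasis_iff_isAlgebraic]
  have hcy : c ∈ (𝕄).closure (insert y (B \ {c})) := by
    refine (Matroid.closure_exchange (f := c) ⟨?_, hy'⟩).1
    rw [Set.insert_sdiff_singleton, Set.insert_eq_of_mem hc, hB.closure_eq]
    exact Set.mem_univ y
  have huniv : (𝕄).closure (insert y (B \ {c})) = Set.univ := by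
    refine Set.eq_univ_of_univ_subset ?_
    have hBE : (𝕄).closure B = Set.univ := hB.closure_eq
    rw [← hBE]
    refine (𝕄).closure_subset_closure_of_subset_closure ?_
    intro b hb
    by_cases hbc : b = c
    · exact hbc ▸ hcy
    · exact (𝕄).mem_closure_of_mem (Set.mem_insert_of_mem _ ⟨hb, hbc⟩) (Set.subset_univ _)
  refine ⟨fun z => ?_⟩
  have hz : IsAlgebraic (Algebra.adjoin ℤ (insert y (B \ {c}))) z :=
    mem_matroid_closure_iff.1 (huniv ▸ Set.mem_univ z)
  have hle : ∀ a ∈ Algebra.adjoin ℤ (insert y (B \ {c})),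
      a ∈ Algebra.adjoin R (Set.range fun _ : Unit => y) := by
    intro a ha
    induction ha using Algebra.adjoin_induction with
    | mem x hx =>
      rcases hx with rfl | hx
      · exact Algebra.subset_adjoin ⟨(), rfl⟩
      · have : x ∈ R := by
          rw [← SetLike.mem_coe, hR]
          exact (𝕄).mem_closure_of_mem hx (Set.subset_univ _)
        exact Subalgebra.algebraMap_mem _ (⟨x, this⟩ : R)
    | algebraMap r => simp
    | add x y _ _ hx hy => exact add_mem hx hy
    | mul x y _ _ hx hy => exact mul_mem hx hy
  let f : Algebra.adjoin ℤ (insert y (B \ {c})) →+*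
      Algebra.adjoin R (Set.range fun _ : Unit => y) :=
    (Algebra.adjoin ℤ (insert y (B \ {c}))).val.toRingHom.codRestrict _ fun a => hle a a.2
  refine hz.ringHom_of_comp_eq f (RingHom.id K) ?_ ?_
  · intro a b hab
    exact Subtype.ext (congrArg (fun c : Algebra.adjoin R _ => (c : K)) hab)
  · ext a
    rfl

end AlgebraicIndependent

/-! ### Plane curves and their fibres -/

section Bivariate

open Polynomial

variable {K : Type*} [Field K] {R : Subalgebra ℤ K}

theorem finite_setOf_map_evalRingHom_eq_zero {P : K[X][X]} (hP : P ≠ 0) :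
    {t | P.map (evalRingHom t) = 0}.Finite := by
  obtain ⟨k, hk⟩ := Polynomial.ext_iff.not.1 hP |> not_forall.1
  refine (finite_setOfPred_isRoot hk).subset fun t ht => ?_
  have := congrArg (fun p => p.coeff k) ht
  simpa using this

/-- A curve over `R` through a point with transcendental first coordinate. -/
theorem exists_bivariate_of_isTranscendenceBasis {c y : K}
    (hc : IsTranscendenceBasis R fun _ : Unit => c) :
    ∃ P : R[X][X], P ≠ 0 ∧
      (P.map (mapRingHom (algebraMap R K))).evalEval c y = 0 := by
  have hinj : Function.Injective (algebraMap R K) := Subtype.val_injective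
  have halg := hc.isAlgebraic.isAlgebraic y
  have hadj : Algebra.adjoin R (Set.range fun _ : Unit => c) = Algebra.adjoin R {c} := by
    rw [Set.range_const]
  rw [hadj] at halg
  obtain ⟨p, hp0, hp⟩ := halg
  -- Every element of `R[c]` is a polynomial in `c`, so the coefficients of `p` lift to `R[X]`; the
  -- inner variable of `P` stands for `c`.
  have hsurj : Function.Surjective
      (((aeval c : R[X] →ₐ[R] K).codRestrict (Algebra.adjoin R {c}) fun q =>
        aeval_mem_adjoin_singleton R c).toRingHom) := by
    rintro ⟨a, ha⟩
    rw [Algebra.adjoin_singleton_eq_range_aeval] at ha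
    obtain ⟨q, rfl⟩ := ha
    exact ⟨q, rfl⟩
  obtain ⟨P, rfl⟩ := Polynomial.map_surjective _ hsurj p
  refine ⟨P, fun h => hp0 (by rw [h, Polynomial.map_zero]), ?_⟩
  rw [← hp, evalEval, aeval_def, eval₂_map]
  rw [eval_map]
  rw [← coe_evalRingHom, hom_eval₂]
  congr 1
  · ext <;> simp
  · simp

/-- If the whole fibre over `t` lies on the curve, every coefficient vanishes at `t`, among them a
nonzero one. -/
theorem isAlgebraic_of_map_evalRingHom_eq_zero {P : R[X][X]} (hP : P ≠ 0) {t : K}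
    (ht : (P.map (mapRingHom (algebraMap R K))).map (evalRingHom t) = 0) : IsAlgebraic R t := by
  obtain ⟨k, hk⟩ := Polynomial.ext_iff.not.1 hP |> not_forall.1
  refine ⟨P.coeff k, hk, ?_⟩
  have := congrArg (fun p => p.coeff k) ht
  simpa [eval_map, aeval_def] using this

theorem evalEval_map_algEquiv (σ : K ≃ₐ[R] K) (P : R[X][X]) (x y : K) :
    (P.map (mapRingHom (algebraMap R K))).evalEval (σ x) (σ y) =
      σ ((P.map (mapRingHom (algebraMap R K))).evalEval x y) := by
  induction P using Polynomial.induction_on' with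
  | add p q hp hq => simp only [Polynomial.map_add, evalEval_add, map_add, hp, hq]
  | monomial n a =>
    have h : ∀ z : K, eval z (a.map (algebraMap R K)) = aeval z a := fun z => by
      rw [eval_map, aeval_def]
    simp only [evalEval, map_monomial, eval_monomial, eval_mul, eval_pow, eval_C, coe_mapRingHom,
      h, map_mul, map_pow]
    rw [aeval_algHom_apply σ]

theorem swap_map_mapRingHom (P : R[X][X]) :
    Bivariate.swap (P.map (mapRingHom (algebraMap R K))) =
      (Bivariate.swap P).map (mapRingHom (algebraMap R K)) := by
  induction P using Polynomial.induction_on' with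
  | add p q hp hq => simp [hp, hq]
  | monomial n a =>
    induction a using Polynomial.induction_on' with
    | add p q hp hq => simp_all
    | monomial m r => simp [Bivariate.swap_monomial_monomial]

theorem evalEval_eq_eval_map {P : K[X][X]} (x y : K) :
    P.evalEval x y = (P.map (evalRingHom x)).eval y := by
  rw [map_evalRingHom_eval]

theorem finite_setOf_evalEval_eq_zero_right {P : K[X][X]} {x : K}
    (h : P.map (evalRingHom x) ≠ 0) : {y | P.evalEval x y = 0}.Finite :=
  (finite_setOfPred_isRoot h).subset fun y hy => by
    rwa [Set.mem_ofPred_eq, evalEval_eq_eval_map] at hy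

theorem finite_setOf_evalEval_eq_zero_left {P : K[X][X]} {y : K}
    (h : (Bivariate.swap P).map (evalRingHom y) ≠ 0) : {x | P.evalEval x y = 0}.Finite :=
  (finite_setOf_evalEval_eq_zero_right h).subset fun x hx => by
    rwa [Set.mem_ofPred_eq, ← coe_aevalAeval_eq_evalEval, Bivariate.aevalAeval_swap,
      coe_aevalAeval_eq_evalEval]

end Bivariate

open FirstOrder FirstOrder.Language

/-! ### Definable sets and automorphisms of the pair -/

section PairDefinability

variable {K : Type u} {inst : pairLanguage.Structure K}

/-- Functions given by terms of the language of pairs with parameters from `A`. -/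
def IsPairTerm (inst : pairLanguage.Structure K) (A : Set K) {α : Type*} (f : (α → K) → K) : Prop :=
  ∃ t : pairLanguage.Term (A ⊕ α), ∀ v, t.realize (Sum.elim (fun a : A => (a : K)) v) = f v

namespace IsPairTerm

variable {A : Set K} {α : Type*} {f g : (α → K) → K}

theorem proj (i : α) : IsPairTerm inst A fun v : α → K => v i :=
  ⟨Term.var (Sum.inr i), fun _ => rfl⟩

theorem const {a : K} (ha : a ∈ A) : IsPairTerm inst A fun _ : α → K => a :=
  ⟨Term.var (Sum.inl ⟨a, ha⟩), fun _ => rfl⟩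

theorem definable_eq (hf : IsPairTerm inst A f) (hg : IsPairTerm inst A g) :
    A.Definable pairLanguage {v | f v = g v} := by
  obtain ⟨s, hs⟩ := hf
  obtain ⟨t, ht⟩ := hg
  refine Set.definable_iff_exists_formula_sum.2 ⟨s.equal t, Set.ext fun v => ?_⟩
  simp [hs, ht]

theorem definable_finite {f : (α → K) → K} (hf : IsPairTerm inst Set.univ f) {T : Set K}
    (hT : T.Finite) : (Set.univ : Set K).Definable pairLanguage {v | f v ∈ T} := by
  induction T, hT using Set.Finite.induction_on with
  | empty => exact Set.definable_empty
  | @insert a s _ _ ih => exact (hf.definable_eq (const (Set.mem_univ a))).union ih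

variable [Field K] {C : Subfield K}

theorem zero (hi : inst = pairStructure C) : IsPairTerm inst A fun _ : α → K => 0 := by
  subst hi
  exact ⟨Term.func (l := 0) (Sum.inl ringFunc.zero) Fin.elim0, fun _ => rfl⟩

theorem one (hi : inst = pairStructure C) : IsPairTerm inst A fun _ : α → K => 1 := by
  subst hi
  exact ⟨Term.func (l := 0) (Sum.inl ringFunc.one) Fin.elim0, fun _ => rfl⟩

theorem neg (hi : inst = pairStructure C) (hf : IsPairTerm inst A f) :
    IsPairTerm inst A fun v => -f v := by
  subst hi
  obtain ⟨s, hs⟩ := hf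
  refine ⟨Term.func (l := 1) (Sum.inl ringFunc.neg) ![s], fun v => congrArg (-·) (hs v)⟩

theorem add (hi : inst = pairStructure C) (hf : IsPairTerm inst A f) (hg : IsPairTerm inst A g) :
    IsPairTerm inst A fun v => f v + g v := by
  subst hi
  obtain ⟨s, hs⟩ := hf
  obtain ⟨t, ht⟩ := hg
  refine ⟨Term.func (l := 2) (Sum.inl ringFunc.add) ![s, t],
    fun v => congrArg₂ (· + ·) (hs v) (ht v)⟩

theorem mul (hi : inst = pairStructure C) (hf : IsPairTerm inst A f) (hg : IsPairTerm inst A g) :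
    IsPairTerm inst A fun v => f v * g v := by
  subst hi
  obtain ⟨s, hs⟩ := hf
  obtain ⟨t, ht⟩ := hg
  refine ⟨Term.func (l := 2) (Sum.inl ringFunc.mul) ![s, t],
    fun v => congrArg₂ (· * ·) (hs v) (ht v)⟩

theorem pow (hi : inst = pairStructure C) (hf : IsPairTerm inst A f) (n : ℕ) :
    IsPairTerm inst A fun v => f v ^ n := by
  induction n with
  | zero => simpa using one hi
  | succ n ih => simpa only [pow_succ] using ih.mul hi hf

theorem const_of_mem_adjoin (hi : inst = pairStructure C) {a : K} (ha : a ∈ Algebra.adjoin ℤ A) :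
    IsPairTerm inst A fun _ : α → K => a := by
  rw [Algebra.adjoin_int, mem_subalgebraOfSubring] at ha
  induction ha using Subring.closure_induction with
  | mem x hx => exact const hx
  | zero => exact zero hi
  | one => exact one hi
  | add x y _ _ hx hy => exact hx.add hi hy
  | neg x _ hx => exact hx.neg hi
  | mul x y _ _ hx hy => exact hx.mul hi hy

-- Coefficients in `ℤ[A]` keep the parameters inside `A`, as saturation over a finite set requires.
open Polynomial in
theorem aeval (hi : inst = pairStructure C) (p : (Algebra.adjoin ℤ A)[X]) (hf : IsPairTerm inst A f) :
    IsPairTerm inst A fun v => Polynomial.aeval (f v) p := by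
  induction p using Polynomial.induction_on' with
  | add p q hp hq => simpa only [map_add] using hp.add hi hq
  | monomial n a =>
    simp only [aeval_monomial]
    exact (const_of_mem_adjoin hi a.2).mul hi (hf.pow hi n)

theorem eval (hi : inst = pairStructure C) (p : Polynomial K) (hf : IsPairTerm inst Set.univ f) :
    IsPairTerm inst Set.univ fun v => p.eval (f v) := by
  induction p using Polynomial.induction_on' with
  | add p q hp hq => simpa only [Polynomial.eval_add] using hp.add hi hq
  | monomial n a =>
    simpa only [Polynomial.eval_monomial] using (const (Set.mem_univ a)).mul hi (hf.pow hi n)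

theorem evalEval (hi : inst = pairStructure C) (p : Polynomial (Polynomial K))
    (hf : IsPairTerm inst Set.univ f) (hg : IsPairTerm inst Set.univ g) :
    IsPairTerm inst Set.univ fun v => p.evalEval (f v) (g v) := by
  induction p using Polynomial.induction_on' with
  | add p q hp hq => simpa only [Polynomial.evalEval_add] using hp.add hi hq
  | monomial n a =>
    have := (hf.eval hi a).mul hi (hg.pow hi n)
    simpa [Polynomial.evalEval] using this

theorem definable_mem (hi : inst = pairStructure C) (hf : IsPairTerm inst A f) :
    A.Definable pairLanguage {v | f v ∈ C} := by
  obtain ⟨s, hs⟩ := hf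
  refine Set.definable_iff_exists_formula_sum.2
    ⟨Relations.formula₁ (Sum.inr PredRel.mem : pairLanguage.Relations 1) s, Set.ext fun v => ?_⟩
  rw [Set.mem_ofPred_eq, Set.mem_ofPred_eq]
  refine Iff.trans ?_ Formula.realize_rel₁.symm
  rw [hs]
  subst hi
  rfl

end IsPairTerm

/-- A field automorphism preserving `C` is an automorphism of the pair. -/
def pairEquiv [Field K] {C : Subfield K} (hi : inst = pairStructure C) (σ : K ≃+* K) (hσ : ∀ x, σ x ∈ C ↔ x ∈ C) :
    pairLanguage.Equiv K K where
  toEquiv := σ.toEquiv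
  map_fun' := by
    subst hi
    intro n F x
    rcases F with F | F
    · cases F
      · exact map_add σ (x 0) (x 1)
      · exact map_mul σ (x 0) (x 1)
      · exact map_neg σ (x 0)
      · exact map_zero σ
      · exact map_one σ
    · exact Empty.elim F
  map_rel' := by
    subst hi
    intro n r x
    rcases r with r | r
    · exact Empty.elim r
    · cases r
      exact hσ (x 0)

theorem comp_mem_of_definable [Field K] {C : Subfield K} (hi : inst = pairStructure C) (σ : K ≃+* K)
    (hσ : ∀ x, σ x ∈ C ↔ x ∈ C) {A : Set K} (hA : ∀ a ∈ A, σ a = a) {α : Type*}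
    {S : Set (α → K)} (hS : A.Definable pairLanguage S) {x : α → K} (hx : x ∈ S) : σ ∘ x ∈ S := by
  obtain ⟨φ, rfl⟩ := Set.definable_iff_exists_formula_sum.1 hS
  have h := (StrongHomClass.realize_formula (pairEquiv hi σ hσ) φ).2 hx
  have e : pairEquiv hi σ hσ ∘ Sum.elim (fun a : A => (a : K)) x =
      Sum.elim (fun a : A => (a : K)) (σ ∘ x) := by
    ext z
    rcases z with a | i
    · exact hA a a.2
    · rfl
  rw [e] at h
  exact h

end PairDefinability

/-! ### Minimality and saturation -/

section Minimal

variable {L : FirstOrder.Language.{v, w}} {M : Type u} [L.Structure M]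

theorem IsStronglyMinimal.definable {n : ℕ} {S : Set (Fin n → M)} (hS : IsStronglyMinimal L S) :
    (Set.univ : Set M).Definable L S := by
  obtain ⟨-, φ, rfl, -⟩ := hS
  refine Set.definable_iff_exists_formula_sum.2
    ⟨φ.relabel (Sum.map (fun a : M => (⟨a, Set.mem_univ a⟩ : (Set.univ : Set M))) id), ?_⟩
  ext x
  simp only [solutionSet, Set.mem_ofPred_eq, Formula.realize_relabel]
  rw [Sum.elim_comp_map]
  rfl

theorem IsStronglyMinimal.finite_or_finite_diff {n : ℕ} {S : Set (Fin n → M)}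
    (hS : IsStronglyMinimal L S) {T : Set (Fin n → M)}
    (hT : (Set.univ : Set M).Definable L T) (hTS : T ⊆ S) : T.Finite ∨ (S \ T).Finite := by
  obtain ⟨-, φ, rfl, h⟩ := hS
  exact h M (ElementaryEmbedding.refl L M) T hT hTS

/-- Saturation yields a point of an infinite definable set avoiding all small definable sets. -/
theorem IsOmegaSaturated.exists_mem_forall_notMem (hM : IsOmegaSaturated L M) {A : Set M}
    (hA : A.Finite) {n : ℕ} {S : Set (Fin n → M)} (hS : A.Definable L S) {i : Fin n}
    (hinf : ((fun x => x i) '' S).Infinite) :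
    ∃ x ∈ S, ∀ T : Set (Fin n → M), A.Definable L T → ((fun x => x i) '' T).Finite → x ∉ T := by
  obtain ⟨φ, hφ⟩ := Set.definable_iff_exists_formula_sum.1 hS
  -- Despite its name, `small` collects the formulas that hold on `S` outside finitely many values
  -- of the `i`-th coordinate; an infinite image makes it finitely satisfiable.
  let small : Set (L.Formula (A ⊕ Fin n)) := {ψ | ((fun x : Fin n → M => x i) ''
    (S \ {x | ψ.Realize (Sum.elim (fun a : A => (a : M)) x)})).Finite}
  obtain ⟨x, hx⟩ := hM A hA n small fun F hF => by
    have hfin : (⋃ ψ ∈ F, (fun x : Fin n → M => x i) ''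
        (S \ {x | ψ.Realize (Sum.elim (fun a : A => (a : M)) x)})).Finite :=
      F.finite_toSet.biUnion fun ψ hψ => hF hψ
    obtain ⟨y, ⟨x, hxS, rfl⟩, hy⟩ := hinf.exists_notMem_finite hfin
    refine ⟨x, fun ψ hψ => by_contra fun hne => hy ?_⟩
    exact Set.mem_biUnion (show ψ ∈ (F : Set _) from hψ) ⟨x, ⟨hxS, hne⟩, rfl⟩
  refine ⟨x, ?_, fun T hT hfin hxT => ?_⟩
  · rw [hφ]
    refine hx φ ?_
    simp only [small, Set.mem_ofPred_eq, ← hφ]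
    simp
  · obtain ⟨ψ, rfl⟩ := Set.definable_iff_exists_formula_sum.1 hT
    have : ψ.not ∈ small := by
      refine hfin.subset (Set.image_mono ?_)
      rintro z ⟨-, hz⟩
      simpa using hz
    have := hx _ this
    rw [Formula.realize_not] at this
    exact this hxT

/-- Some coordinate takes infinitely many values on a minimal set, and it is finite-to-one. -/
theorem IsStronglyMinimal.exists_coordinate {n : ℕ} {S : Set (Fin n → M)}
    (hS : IsStronglyMinimal L S) : ∃ i : Fin n, ((fun x => x i) '' S).Infinite ∧
      ∀ u : M, {x ∈ S | x i = u}.Finite := by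
  obtain ⟨i, hi⟩ : ∃ i : Fin n, ((fun x => x i) '' S).Infinite := by
    by_contra! h
    refine hS.1 ((Set.Finite.pi' fun i => h i).subset ?_)
    exact fun x hx i => ⟨x, hx, rfl⟩
  refine ⟨i, hi, fun u => ?_⟩
  have hdef : (Set.univ : Set M).Definable L {x : Fin n → M | x i = u} := by
    refine Set.definable_iff_exists_formula_sum.2
      ⟨(Term.var (Sum.inr i)).equal (Term.var (Sum.inl ⟨u, Set.mem_univ u⟩)), ?_⟩
    ext x
    simp
  -- A cofinite fibre would leave the coordinate only finitely many values.
  refine (hS.finite_or_finite_diff (hS.definable.inter hdef) Set.inter_subset_left).resolve_right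
    fun h => hi (((h.image fun x => x i).insert u).subset ?_)
  rintro _ ⟨x, hx, rfl⟩
  by_cases hxu : x i = u
  · exact Or.inl hxu
  · exact Or.inr ⟨x, ⟨hx, fun hx' => hxu hx'.2⟩, rfl⟩

end Minimal

/-! ### Non-orthogonality to the subfield -/

section Nonorthogonality

open FirstOrder FirstOrder.Language Polynomial AlgebraicIndependent

variable {K : Type u} [Field K] {C : Subfield K} {inst : pairLanguage.Structure K}

/-- A minimal set cannot have a point with a coordinate that can be moved freely over `C`. -/
theorem false_of_free_coordinate [CharZero K] (hi : inst = pairStructure C) {n : ℕ}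
    {S : Set (Fin n → K)} (hS : IsStronglyMinimal pairLanguage S) (i : Fin n) {y : K} (hy : y ∉ C)
    (h : ∀ k : ℕ, ∀ r : ℤ, (r = 1 ∨ r = 2) → ∃ x ∈ S, x i = r * y + k) : False := by
  have hinf : ∀ r : ℤ, (r = 1 ∨ r = 2) → {x ∈ S | x i - r * y ∈ C}.Infinite := by
    intro r hr
    choose f hfS hf using fun k => h k r hr
    refine Set.infinite_of_injective_forall_mem (f := f) (fun a b hab => ?_) fun k =>
      ⟨hfS k, by simp [hf k]⟩
    have h1 := hf a
    rw [hab, hf b] at h1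
    exact_mod_cast (add_left_cancel h1).symm
  have hdef : (Set.univ : Set K).Definable pairLanguage
      {x : Fin n → K | x i - (1 : ℤ) * y ∈ C} := by
    simp only [sub_eq_add_neg]
    exact IsPairTerm.definable_mem hi ((IsPairTerm.proj i).add hi
      (IsPairTerm.const (Set.mem_univ _)))
  -- The points near `y` and near `2y` modulo `C` form disjoint infinite sets: a common point would
  -- put `2y - y = y` in `C`.
  rcases hS.finite_or_finite_diff (hS.definable.inter hdef) Set.inter_subset_left with hT | hT
  · exact hinf 1 (Or.inl rfl) hT
  · refine hinf 2 (Or.inr rfl) (hT.subset ?_)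
    rintro x ⟨hx, hx2⟩
    refine ⟨hx, fun hx1 => hy ?_⟩
    have := sub_mem hx1.2 hx2
    convert this using 1
    push_cast
    ring

/-- A set whose coordinate satisfies an algebraic relation with infinitely many elements of `C`
is non-orthogonal to `C`. -/
theorem isNonorthogonal_of_curve (hi : inst = pairStructure C) {n : ℕ}
    {S : Set (Fin n → K)} (hS : (Set.univ : Set K).Definable pairLanguage S) (i : Fin n)
    (hfib : ∀ u : K, {x ∈ S | x i = u}.Finite) {P : K[X][X]} (hP : P ≠ 0)
    (h : {t : K | t ∈ C ∧ P.map (evalRingHom t) ≠ 0 ∧ ∃ x ∈ S, P.evalEval t (x i) = 0 ∧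
      (Bivariate.swap P).map (evalRingHom (x i)) ≠ 0}.Infinite) :
    IsNonorthogonal pairLanguage S {x : Fin 1 → K | x 0 ∈ C} := by
  have hP' : Bivariate.swap P ≠ 0 := by simpa using hP
  -- The curve with its finitely many full vertical and horizontal lines removed, so that every
  -- remaining fibre is finite.
  let R : Set (Fin n ⊕ Fin 1 → K) := {v | v ∘ Sum.inl ∈ S} ∩ {v | v (Sum.inr 0) ∈ C} ∩
    {v | P.evalEval (v (Sum.inr 0)) (v (Sum.inl i)) = 0} ∩
    {v | v (Sum.inr 0) ∈ {t | P.map (evalRingHom t) = 0}}ᶜ ∩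
    {v | v (Sum.inl i) ∈ {t | (Bivariate.swap P).map (evalRingHom t) = 0}}ᶜ
  have hRdef : (Set.univ : Set K).Definable pairLanguage R := by
    have h0 : IsPairTerm inst Set.univ fun v : Fin n ⊕ Fin 1 → K => v (Sum.inr 0) :=
      IsPairTerm.proj _
    have h1 : IsPairTerm inst Set.univ fun v : Fin n ⊕ Fin 1 → K => v (Sum.inl i) :=
      IsPairTerm.proj _
    refine ((((hS.preimage_comp Sum.inl).inter (h0.definable_mem hi)).inter
      ((h0.evalEval hi P h1).definable_eq (IsPairTerm.zero hi))).inter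
      (h0.definable_finite ?_).compl).inter (h1.definable_finite ?_).compl
    · exact finite_setOf_map_evalRingHom_eq_zero hP
    · exact finite_setOf_map_evalRingHom_eq_zero hP'
  refine ⟨R, hRdef, ?_, ?_, ?_, ?_⟩
  · refine Set.Infinite.of_image (fun v => v (Sum.inr 0)) (h.mono ?_)
    rintro t ⟨htC, ht, x, hxS, hx, hx'⟩
    exact ⟨Sum.elim x fun _ => t, ⟨⟨⟨⟨hxS, htC⟩, hx⟩, ht⟩, hx'⟩, rfl⟩
  · rintro s t ⟨⟨⟨⟨hs, ht⟩, -⟩, -⟩, -⟩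
    exact ⟨hs, ht⟩
  · intro s _
    by_cases hs' : (Bivariate.swap P).map (evalRingHom (s i)) = 0
    · refine Set.finite_empty.subset ?_
      rintro t ⟨-, h2⟩
      exact h2 hs'
    · refine Set.Finite.of_finite_image
        ((finite_setOf_evalEval_eq_zero_left hs').subset ?_)
        (f := fun t : Fin 1 → K => t 0) ?_
      · rintro _ ⟨t, ⟨⟨⟨-, h1⟩, -⟩, -⟩, rfl⟩
        exact h1
      · intro t _ t' _ htt
        ext j
        rw [Subsingleton.elim j 0]
        exact htt
  · intro t _
    by_cases ht' : P.map (evalRingHom (t 0)) = 0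
    · refine Set.finite_empty.subset ?_
      rintro s ⟨⟨-, h2⟩, -⟩
      exact h2 ht'
    · refine ((finite_setOf_evalEval_eq_zero_right ht').biUnion fun u _ => hfib u).subset ?_
      rintro s ⟨⟨⟨⟨hs, -⟩, h1⟩, -⟩, -⟩
      exact Set.mem_biUnion (x := s i) h1 ⟨hs, rfl⟩

/-- Saturation yields a point of `S` whose `i`-th coordinate is transcendental over a given finite
set. -/
theorem exists_mem_notMem_matroid_closure [CharZero K] (hi : inst = pairStructure C)
    (hsat : IsOmegaSaturated pairLanguage K) {A B : Set K} (hA : A.Finite) (hB : B.Finite) {n : ℕ}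
    {S : Set (Fin n → K)} (hS : A.Definable pairLanguage S) {i : Fin n}
    (hinf : ((fun x => x i) '' S).Infinite) :
    ∃ x ∈ S, x i ∉ (AlgebraicIndependent.matroid ℤ K).closure B := by
  obtain ⟨x, hxS, hx⟩ := hsat.exists_mem_forall_notMem (hA.union hB)
    (hS.mono Set.subset_union_left) hinf
  refine ⟨x, hxS, fun hxB => ?_⟩
  have hxAB := mem_matroid_closure_iff.1
    ((AlgebraicIndependent.matroid ℤ K).closure_subset_closure
      (Set.subset_union_right (s := A)) hxB)
  obtain ⟨p, hp0, hp⟩ := hxAB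
  -- A nonzero polynomial has finitely many roots, so this set has finite `i`-th projection.
  refine hx {v | aeval (v i) p = 0}
    (((IsPairTerm.proj i).aeval hi p).definable_eq (IsPairTerm.zero hi)) ?_ hp
  have hp' : p.map (algebraMap (Algebra.adjoin ℤ (A ∪ B)) K) ≠ 0 :=
    (Polynomial.map_ne_zero_iff Subtype.val_injective).2 hp0
  refine (finite_setOfPred_isRoot hp').subset ?_
  rintro _ ⟨v, hv, rfl⟩
  simpa [IsRoot, eval_map, aeval_def] using hv

theorem isNonorthogonal_of_isStronglyMinimal [CharZero K] [IsAlgClosed K] [IsAlgClosed C]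
    (hi : inst = pairStructure C) (hsat : IsOmegaSaturated pairLanguage K) {n : ℕ}
    {S : Set (Fin n → K)} (hS : IsStronglyMinimal pairLanguage S) :
    IsNonorthogonal pairLanguage S {x : Fin 1 → K | x 0 ∈ C} := by
  obtain ⟨A, -, hA⟩ := Set.definable_iff_finitely_definable.1 hS.definable
  obtain ⟨i, hinf, hfib⟩ := hS.exists_coordinate
  obtain ⟨B₀, B, hB₀C, hCB₀, hB₀B, hB⟩ := exists_base_of_subfield C
  obtain ⟨B₁, hB₁B, hB₁, hAB₁⟩ := exists_finite_subset_closure (B := B) A.finite_toSet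
    (by rw [hB.closure_eq]; exact Set.subset_univ _)
  obtain ⟨x, hxS, hx⟩ := exists_mem_notMem_matroid_closure hi hsat A.finite_toSet hB₁ hA hinf
  obtain ⟨c, ⟨hcB, hcB₁⟩, hxc⟩ := exists_notMem_closure_diff_singleton hB hB₁B hx
  obtain ⟨R, hR, hflat⟩ := exists_subalgebra_eq_matroid_closure (B \ {c})
  have hclR : ∀ s ⊆ B \ {c}, ∀ z ∈ (AlgebraicIndependent.matroid ℤ K).closure s, z ∈ R := by
    intro s hs z hz
    rw [← SetLike.mem_coe, hR]
    exact (AlgebraicIndependent.matroid ℤ K).closure_subset_closure hs hz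
  have hBR : ∀ b ∈ B, b ≠ c → b ∈ R := fun b hb hbc => hclR _ subset_rfl b
    ((AlgebraicIndependent.matroid ℤ K).mem_closure_of_mem ⟨hb, hbc⟩ (Set.subset_univ _))
  have hAR : ∀ a ∈ A, a ∈ R := fun a ha =>
    hclR B₁ (fun b hb => ⟨hB₁B hb, fun h => hcB₁ (h ▸ hb)⟩) a (hAB₁ ha)
  have hfix : ∀ (σ : K ≃ₐ[R] K) z, z ∈ R → σ z = z := fun σ z hz => σ.commutes ⟨z, hz⟩
  have hbasis : ∀ z : K, z ∉ R → IsTranscendenceBasis R fun _ : Unit => z := fun z hz =>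
    isTranscendenceBasis_of_notMem_closure hB hcB hR hflat hz
  have hy : x i ∉ R := by rwa [← SetLike.mem_coe, hR]
  have hnat : ∀ (z : K) (k : ℕ), z ∉ R → z + k ∉ R := fun z k hz h =>
    hz (by simpa using sub_mem h (natCast_mem R k))
  by_cases hc : c ∈ B₀
  · have hcR : c ∉ R := by
      rw [← SetLike.mem_coe, hR]
      exact hB.indep.notMem_closure_sdiff_of_mem hcB
    have hcC : c ∈ C := hB₀C hc
    choose σ hσ using fun k : ℕ =>
      exists_algEquiv_apply_eq (hbasis c hcR) (hbasis _ (hnat c k hcR))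
    have hB₀σ : ∀ τ : K ≃ₐ[R] K, τ c ∈ C → ∀ z ∈ C, τ z ∈ C := by
      intro τ hτ z hz
      refine map_mem_of_subset_closure hCB₀ τ.toRingEquiv (fun b hb => ?_) hz
      by_cases hbc : b = c
      · exact hbc ▸ hτ
      · have : τ b = b := hfix τ b (hBR b (hB₀B hb) hbc)
        exact this.symm ▸ hB₀C hb
    have hσC : ∀ k z, σ k z ∈ C ↔ z ∈ C := by
      intro k z
      refine ⟨fun hz => ?_, hB₀σ (σ k) (by rw [hσ]; exact add_mem hcC (natCast_mem C k)) z⟩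
      -- The inverse also moves `c` within `C`, which gives the converse inclusion.
      have hsymm : (σ k).symm c = c - k := by
        rw [AlgEquiv.symm_apply_eq, map_sub, hσ, map_natCast, add_sub_cancel_right]
      have := hB₀σ (σ k).symm (by rw [hsymm]; exact sub_mem hcC (natCast_mem C k)) _ hz
      rwa [AlgEquiv.symm_apply_apply] at this
    obtain ⟨P, hP0, hP⟩ := exists_bivariate_of_isTranscendenceBasis (y := x i) (hbasis c hcR)
    have hinj : Function.Injective (mapRingHom (algebraMap R K)) :=
      Polynomial.map_injective _ Subtype.val_injective
    refine isNonorthogonal_of_curve hi hS.definable i hfib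
      ((Polynomial.map_ne_zero_iff hinj).2 hP0) ?_
    refine Set.infinite_of_injective_forall_mem (f := fun k : ℕ => c + k)
      (fun a b hab => by simpa using hab) fun k => ⟨add_mem hcC (natCast_mem C k), fun h0 => ?_,
        σ k ∘ x, comp_mem_of_definable hi (σ k).toRingEquiv (hσC k)
          (fun a ha => hfix _ a (hAR a ha)) hA hxS, ?_, fun h0 => ?_⟩
    · exact hnat c k hcR (hflat _ (isAlgebraic_of_map_evalRingHom_eq_zero hP0 h0))
    · rw [Function.comp_apply, ← hσ k, evalEval_map_algEquiv, hP, map_zero]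
    · rw [swap_map_mapRingHom] at h0
      have halg := hflat _ (isAlgebraic_of_map_evalRingHom_eq_zero (by simpa using hP0) h0)
      refine hy ?_
      have := hfix (σ k).symm _ halg
      rw [Function.comp_apply, AlgEquiv.symm_apply_apply] at this
      exact this ▸ halg
  · exfalso
    have hCR : ∀ z ∈ C, z ∈ R := fun z hz =>
      hclR B₀ (fun b hb => ⟨hB₀B hb, fun h => hc (h ▸ hb)⟩) z (hCB₀ hz)
    refine false_of_free_coordinate hi hS i (fun h => hy (hCR _ h)) fun k r hr => ?_
    have hr' : (r : K) * x i + k ∉ R := by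
      refine hnat _ k fun h => hy (hflat _ ?_)
      have hr0 : (r : K) ≠ 0 := by rcases hr with rfl | rfl <;> simp
      refine IsAlgebraic.of_mul (mem_nonZeroDivisors_of_ne_zero hr0) ?_
        (isAlgebraic_algebraMap (⟨_, h⟩ : R))
      exact isAlgebraic_algebraMap (⟨r, intCast_mem R r⟩ : R)
    obtain ⟨σ, hσ⟩ := exists_algEquiv_apply_eq (hbasis _ hy) (hbasis _ hr')
    have hσC : ∀ z, σ z ∈ C ↔ z ∈ C := by
      refine fun z => ⟨fun hz => ?_, fun hz => ?_⟩
      · have := hfix σ.symm _ (hCR _ hz)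
        rw [AlgEquiv.symm_apply_apply] at this
        exact this ▸ hz
      · exact (hfix σ z (hCR z hz)).symm ▸ hz
    exact ⟨σ ∘ x, comp_mem_of_definable hi σ.toRingEquiv hσC
      (fun a ha => hfix _ a (hAR a ha)) hA hxS, hσ⟩

end Nonorthogonality

theorem theorem2p4 {K : Type u} [Field K] [IsAlgClosed K] [CharZero K]
    (C : Subfield K) [IsAlgClosed C] :
    letI : pairLanguage.Structure K := pairStructure C
    IsOmegaSaturated pairLanguage K →
      ∀ (n : ℕ) (S : Set (Fin n → K)), IsStronglyMinimal pairLanguage S →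
        IsNonorthogonal pairLanguage S {x : Fin 1 → K | x 0 ∈ C} := by
  intro hsat n S hS
  exact isNonorthogonal_of_isStronglyMinimal rfl hsat hS
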